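/- Let $\mathfrak R$ be an associative unital topological ring whose open right ideals form a base of neighborhoods of zero, and assume that $\mathfrak R$ is complete and separated. For a set $X$, let $\mathfrak R[[X]]$ be the set of all formal linear combinations $\sum_{x\in X} r_x x$ whose family of coefficients $(r_x\in\mathfrak R)_{x\in X}$ converges to zero, i.e., for every open right ideal $\mathfrak I$ one has $r_x\in\mathfrak I$ for all but finitely many $x$. The functor $X\mapsto\mathfrak R[[X]]$ is a monad on the category of sets, with unit the point measures $X\to\mathfrak R[[X]]$ and with multiplication $\mathfrak R[[\mathfrak R[[X]]]]\to\mathfrak R[[X]]$ the opening of parentheses (infinite sums being limits of finite partial sums in $\mathfrak R$). A left $\mathfrak R$-contramodule is an algebra over this monad, i.e., a set $\mathfrak P$ with a contraaction map $\pi_{\mathfrak P}\colon\mathfrak R[[\mathfrak P]]\to\mathfrak P$ satisfying the associativity and unitality equations; $\mathfrak R\text{-contra}$ is the abelian category of left $\mathfrak R$-contramodules. A right $\mathfrak R$-module $\mathcal N$ is discrete if the annihilator of each element of $\mathcal N$ is open in $\mathfrak R$. For such $\mathcal N$ and a left $\mathfrak R$-contramodule $\mathfrak P$, the contratensor product $\mathcal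 N\odot_{\mathfrak R}\mathfrak P$ is the cokernel of the difference of the two maps $\mathcal N\otimes_{\mathbb Z}\mathfrak R[[\mathfrak P]]\rightrightarrows\mathcal N\otimes_{\mathbb Z}\mathfrak P$ given by $b\otimes\sum_p r_p p\mapsto b\otimes\pi_{\mathfrak P}(\sum_p r_p p)$ and $b\otimes\sum_p r_p p\mapsto\sum_p br_p\otimes p$. Let $\mathrm{Ctrtor}^{\mathfrak R}_i(\mathcal N,-)$ be the left derived functors of $\mathcal N\odot_{\mathfrak R}-$, computed by projective resolutions in $\mathfrak R\text{-contra}$. A left $\mathfrak R$-contramodule $\mathfrak F$ is $1$-strictly flat if $\mathrm{Ctrtor}^{\mathfrak R}_1(\mathcal N,\mathfrak F)=0$ for all discrete right $\mathfrak R$-modules $\mathcal N$. Then the class of all $1$-strictly flat left $\mathfrak R$-contramodules is closed under direct limits (colimits of diagrams indexed by directed posets) in $\mathfrak R\text{-contra}$. In particular, all direct limits in $\mathfrak R\text{-contra}$ of diagrams of projective left $\mathfrak R$-contramodules indexed by directed posets are $1$-strictly flat. -/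

import Mathlib

set_option linter.unusedSectionVars false
set_option linter.style.haveILetI false

universe u

open CategoryTheory CategoryTheory.Limits
open Filter (Tendsto cofinite)
open scoped Topology TensorProduct

noncomputable section

namespace Contra

section

variable {R : Type u} [Ring R] [UniformSpace R] [IsUniformAddGroup R] [IsTopologicalRing R]
  [IsLinearTopology Rᵐᵒᵖ R] [T2Space R] [CompleteSpace R]

/-! ### Zero-convergent families of coefficients: the sets `R[[X]]` -/

variable (R) in
/-- The group `R[[X]]` of all families `X → R` converging to zero in the topology of `R`, i.e. such
that for every neighbourhood `U` of zero all but finitely many coefficients lie in `U`. -/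
def formalSum (X : Type u) : AddSubgroup (X → R) where
  carrier := {r | Tendsto r cofinite (𝓝 0)}
  add_mem' {a b} ha hb := by
    have h : Tendsto (a + b) cofinite (𝓝 (0 + 0)) := Tendsto.add ha hb
    rwa [add_zero] at h
  zero_mem' := tendsto_const_nhds
  neg_mem' {a} ha := by
    have h : Tendsto (-a) cofinite (𝓝 (-0)) := Tendsto.neg ha
    rwa [neg_zero] at h

variable (R) in
/-- Infinite formal linear combinations of elements of `X` with zero-convergent coefficients. -/
abbrev FormalSum (X : Type u) : Type u := formalSum R X

variable {X Y Z : Type u}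

/-- Convergence to zero may be tested on open right ideals. -/
theorem mem_formalSum_iff {r : X → R} :
    r ∈ formalSum R X ↔
      ∀ I : Submodule Rᵐᵒᵖ R, IsOpen (I : Set R) → {x | r x ∉ I}.Finite := by
  change Tendsto r cofinite (𝓝 0) ↔ _
  rw [(IsLinearTopology.hasBasis_open_submodule (M := R) Rᵐᵒᵖ).tendsto_right_iff]
  rfl

theorem summable_of_tendsto {ι : Type*} {r : ι → R} (h : Tendsto r cofinite (𝓝 0)) :
    Summable r := by
  haveI : NonarchimedeanAddGroup R :=
    { is_nonarchimedean := fun U hU => by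
        obtain ⟨I, hI, hIU⟩ :=
          (IsLinearTopology.hasBasis_open_submodule (M := R) Rᵐᵒᵖ).mem_iff.1 hU
        exact ⟨⟨I.toAddSubgroup, hI⟩, hIU⟩ }
  exact NonarchimedeanAddGroup.summable_of_tendsto_cofinite_zero h

theorem summable_of_openIdeals {ι : Type*} {r : ι → R}
    (h : ∀ I : Submodule Rᵐᵒᵖ R, IsOpen (I : Set R) → {x | r x ∉ I}.Finite) : Summable r := by
  apply summable_of_tendsto
  rw [(IsLinearTopology.hasBasis_open_submodule (M := R) Rᵐᵒᵖ).tendsto_right_iff]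
  exact h

theorem tsum_mem_openIdeal {ι : Type*} {r : ι → R} (I : Submodule Rᵐᵒᵖ R)
    (hI : IsOpen (I : Set R)) (h : ∀ i, r i ∈ I) : ∑' i, r i ∈ I := by
  have hc : IsClosed (I : Set R) := I.toAddSubgroup.isClosed_of_isOpen hI
  exact tsum_mem (s := I.toAddSubgroup) hc h

theorem mul_mem_right {I : Submodule Rᵐᵒᵖ R} {a : R} (ha : a ∈ I) (b : R) : a * b ∈ I :=
  I.smul_mem (MulOpposite.op b) ha

theorem FormalSum.finite_notMem (r : FormalSum R X) (I : Submodule Rᵐᵒᵖ R)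
    (hI : IsOpen (I : Set R)) : {x | r.1 x ∉ I}.Finite := mem_formalSum_iff.1 r.2 I hI

theorem FormalSum.summable (r : FormalSum R X) : Summable r.1 := summable_of_tendsto r.2

theorem FormalSum.finite_mul_notMem (r : FormalSum R X) (a : R) (I : Submodule Rᵐᵒᵖ R)
    (hI : IsOpen (I : Set R)) : {x | a * r.1 x ∉ I}.Finite := by
  have h : Tendsto (fun x => a * r.1 x) cofinite (𝓝 (a * 0)) := Tendsto.const_mul a r.2
  rw [mul_zero] at h
  exact mem_formalSum_iff.1 (show (fun x => a * r.1 x) ∈ formalSum R X from h) I hI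

theorem summable_mul (r : FormalSum R X) (g : X → R) : Summable fun x => r.1 x * g x :=
  summable_of_openIdeals fun I hI =>
    (r.finite_notMem I hI).subset fun _ hx hr => hx (mul_mem_right hr _)

/-- The substitution `∑ r_x x ↦ ∑ r_x g(x)`: an auxiliary common form of the two operations below,
used to prove their properties. -/
def bind (g : X → FormalSum R Y) : FormalSum R X →+ FormalSum R Y where
  toFun r := ⟨fun y => ∑' x, r.1 x * (g x).1 y, mem_formalSum_iff.2 fun I hI => by
    refine ((r.finite_notMem I hI).biUnion
      (fun x _ => (g x).finite_mul_notMem (r.1 x) I hI)).subset fun y hy => ?_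
    by_contra hcon
    simp only [Set.mem_iUnion, Set.mem_ofPred_eq, not_exists, not_not] at hcon
    refine hy (tsum_mem_openIdeal I hI fun x => ?_)
    by_cases hx : r.1 x ∈ I
    · exact mul_mem_right hx _
    · exact hcon x hx⟩
  map_zero' := by
    ext y
    simp
  map_add' r s := by
    ext y
    simp only [AddSubgroup.coe_add, Pi.add_apply, add_mul]
    exact (summable_mul r fun x => (g x).1 y).tsum_add (summable_mul s fun x => (g x).1 y)

theorem bind_bind (g : X → FormalSum R Y) (h : Y → FormalSum R Z) (r : FormalSum R X) :
    bind h (bind g r) = bind (fun x => bind h (g x)) r := by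
  ext z
  change ∑' y, (∑' x, r.1 x * (g x).1 y) * (h y).1 z
    = ∑' x, r.1 x * ∑' y, (g x).1 y * (h y).1 z
  have hs : Summable (Function.uncurry fun (x : X) (y : Y) =>
      r.1 x * (g x).1 y * (h y).1 z) := by
    apply summable_of_openIdeals
    intro I hI
    refine ((r.finite_notMem I hI).biUnion (fun x _ =>
      ((g x).finite_mul_notMem (r.1 x) I hI).image (Prod.mk x))).subset ?_
    rintro ⟨x, y⟩ hxy
    simp only [Function.uncurry, Set.mem_ofPred_eq] at hxy
    have h2 : r.1 x * (g x).1 y ∉ I := fun hh => hxy (mul_mem_right hh _)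
    have h1 : r.1 x ∉ I := fun hh => h2 (mul_mem_right hh _)
    exact Set.mem_biUnion h1 ⟨y, h2, rfl⟩
  calc ∑' y, (∑' x, r.1 x * (g x).1 y) * (h y).1 z
      = ∑' y, ∑' x, r.1 x * (g x).1 y * (h y).1 z := by
        refine tsum_congr fun y => ?_
        exact ((summable_mul r fun x => (g x).1 y).tsum_mul_right _).symm
    _ = ∑' x, ∑' y, r.1 x * (g x).1 y * (h y).1 z := hs.tsum_comm
    _ = _ := by
        refine tsum_congr fun x => ?_
        simp only [mul_assoc]
        exact (summable_mul (g x) fun y => (h y).1 z).tsum_mul_left _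

open Classical in
variable (R) in
/-- The point measure `ε_X : X → R[[X]]`. -/
def point (x : X) : FormalSum R X :=
  ⟨Pi.single x 1, mem_formalSum_iff.2 fun I _ => (Set.finite_singleton x).subset fun y hy => by
    by_contra hne
    exact hy (by rw [Pi.single_eq_of_ne hne]; exact I.zero_mem)⟩

theorem bind_point (g : X → FormalSum R Y) (x : X) : bind g (point R x) = g x := by
  classical
  ext y
  change ∑' x', (point R x).1 x' * (g x').1 y = (g x).1 y
  rw [tsum_eq_single x]
  · simp [point]
  · intro x' hx'
    simp [point, Pi.single_eq_of_ne hx']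

theorem bind_point_self (r : FormalSum R X) : bind (point R) r = r := by
  classical
  ext y
  change ∑' x, r.1 x * (point R x).1 y = r.1 y
  rw [tsum_eq_single y]
  · simp [point]
  · intro x hx
    simp [point, Pi.single_eq_of_ne hx.symm]

theorem map_aux (f : X → Y) (r : FormalSum R X) (y : Y) :
    ∑' x : {x : X // f x = y}, r.1 x = (bind (fun x => point R (f x)) r).1 y := by
  classical
  change _ = ∑' x, r.1 x * (point R (f x)).1 y
  rw [← tsum_subtype_eq_of_support_subset (s := {x | f x = y})]
  · refine tsum_congr fun x => ?_
    have hx : f x.1 = y := x.2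
    simp [point, hx]
  · intro x hx
    by_contra hne
    have hne' : y ≠ f x := fun h => hne h.symm
    exact hx (by simp [point, Pi.single_eq_of_ne hne'])

/-- The map `R[[f]] : R[[X]] → R[[Y]]` induced by `f : X → Y`: the coefficient at `y` of the image
of `∑ r_x x` is the sum of the family of all `r_x` with `f(x) = y`. -/
def map (f : X → Y) : FormalSum R X →+ FormalSum R Y where
  toFun r := ⟨fun y => ∑' x : {x : X // f x = y}, r.1 x, by
    simp only [map_aux]
    exact (bind _ r).2⟩
  map_zero' := by
    ext y
    simp
  map_add' r s := by
    ext y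
    simp only [map_aux, map_add]

/-- The opening of parentheses `φ_X : R[[R[[X]]]] → R[[X]]`: the coefficient at `x` of the image of
`∑ r_s s` is the sum of the family of all products `r_s s_x`. -/
def join : FormalSum R (FormalSum R X) →+ FormalSum R X where
  toFun r := ⟨fun x => ∑' s : FormalSum R X, r.1 s * s.1 x, (bind id r).2⟩
  map_zero' := map_zero (bind id)
  map_add' := map_add (bind id)

theorem map_eq_bind (f : X → Y) (r : FormalSum R X) :
    map f r = bind (fun x => point R (f x)) r := by
  ext y
  exact map_aux f r y

theorem join_eq_bind (r : FormalSum R (FormalSum R X)) : join r = bind id r := rfl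

/-! The equations of the monad `R[[-]]` on the category of sets. -/

theorem map_id (r : FormalSum R X) : map id r = r := by
  rw [map_eq_bind]
  exact bind_point_self r

theorem map_map (f : X → Y) (g : Y → Z) (r : FormalSum R X) :
    map g (map f r) = map (g ∘ f) r := by
  simp only [map_eq_bind, bind_bind, bind_point]
  rfl

theorem map_point (f : X → Y) (x : X) : map f (point R x) = point R (f x) := by
  rw [map_eq_bind, bind_point]

theorem map_join (f : X → Y) (r : FormalSum R (FormalSum R X)) :
    map f (join r) = join (map (map f) r) := by
  simp only [map_eq_bind, join_eq_bind, bind_bind, bind_point]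
  rfl

theorem join_point (r : FormalSum R X) : join (point R r) = r := bind_point id r

theorem join_map_point (r : FormalSum R X) : join (map (point R) r) = r := by
  simp only [map_eq_bind, join_eq_bind, bind_bind, bind_point, id]
  exact bind_point_self r

theorem join_join (r : FormalSum R (FormalSum R (FormalSum R X))) :
    join (join r) = join (map join r) := by
  simp only [map_eq_bind, join_eq_bind, bind_bind, bind_point, id]

end

/-! ### Left contramodules -/

section

variable (R : Type u) [Ring R] [UniformSpace R] [IsUniformAddGroup R] [IsTopologicalRing R]
  [IsLinearTopology Rᵐᵒᵖ R] [T2Space R] [CompleteSpace R]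

/-- A left `R`-contramodule: an algebra over the monad `R[[-]]`. -/
structure Contramodule where
  /-- The underlying set. -/
  carrier : Type u
  /-- The left contraaction map. -/
  act : FormalSum R carrier → carrier
  act_point : ∀ c, act (point R c) = c
  act_join : ∀ r, act (join r) = act (map act r)

variable {R}

namespace Contramodule

instance : CoeSort (Contramodule R) (Type u) := ⟨carrier⟩

/-- A morphism of contramodules. -/
@[ext]
structure Hom (P Q : Contramodule R) where
  /-- The underlying map. -/
  toFun : P → Q
  map_act : ∀ r, toFun (P.act r) = Q.act (map toFun r)

/-- The category `R-contra` of left `R`-contramodules. -/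
instance : Category (Contramodule R) where
  Hom := Hom
  id P := ⟨id, fun r => by rw [map_id]; rfl⟩
  comp f g := ⟨g.toFun ∘ f.toFun, fun r => by
    rw [← map_map, ← g.map_act, ← f.map_act]; rfl⟩

/-! The underlying abelian group of a contramodule: finite sums are the values of the contraaction
on finite formal linear combinations. -/

variable (P Q : Contramodule R)

instance : Zero P := ⟨P.act 0⟩
instance : Add P := ⟨fun a b => P.act (point R a + point R b)⟩
instance : Neg P := ⟨fun a => P.act (-point R a)⟩

theorem act_zero : P.act 0 = 0 := rfl

theorem act_add (r s : FormalSum R P) : P.act (r + s) = P.act r + P.act s := by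
  have h := P.act_join (point R r + point R s)
  rwa [map_add, map_add, join_point, join_point, map_point, map_point] at h

theorem act_neg (r : FormalSum R P) : P.act (-r) = -P.act r := by
  have h := P.act_join (-point R r)
  rwa [map_neg, map_neg, join_point, map_point] at h

theorem act_surjective : Function.Surjective P.act := fun c => ⟨_, P.act_point c⟩

instance : AddCommGroup P :=
  { AddGroup.ofLeftAxioms
      (fun a b c : P => by
        obtain ⟨a, rfl⟩ := P.act_surjective a
        obtain ⟨b, rfl⟩ := P.act_surjective b
        obtain ⟨c, rfl⟩ := P.act_surjective c
        simp only [← act_add, add_assoc])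
      (fun a : P => by
        obtain ⟨a, rfl⟩ := P.act_surjective a
        rw [← act_zero, ← act_add, zero_add])
      (fun a : P => by
        obtain ⟨a, rfl⟩ := P.act_surjective a
        rw [← act_neg, ← act_add, neg_add_cancel, act_zero]) with
    add_comm := fun a b => by
      obtain ⟨a, rfl⟩ := P.act_surjective a
      obtain ⟨b, rfl⟩ := P.act_surjective b
      rw [← act_add, ← act_add, add_comm] }

variable {P Q}

/-- A morphism of contramodules as a homomorphism of abelian groups. -/
def Hom.toAddMonoidHom (f : P ⟶ Q) : P →+ Q where
  toFun := f.toFun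
  map_zero' := by rw [← act_zero, f.map_act, map_zero, act_zero]
  map_add' a b := by
    obtain ⟨a, rfl⟩ := P.act_surjective a
    obtain ⟨b, rfl⟩ := P.act_surjective b
    rw [← act_add, f.map_act, map_add, act_add, ← f.map_act, ← f.map_act]

theorem act_map_zero (X : Type u) (r : FormalSum R X) :
    P.act (map (fun _ => (0 : P)) r) = 0 := by
  have h : map (fun _ => (0 : P)) r = map P.act (map (fun _ : X => (0 : FormalSum R P)) r) := by
    rw [map_map]; rfl
  rw [h, ← act_join, ← act_zero]
  congr 1
  rw [map_eq_bind, join_eq_bind, bind_bind]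
  simp only [bind_point]
  ext y
  change ∑' x, r.1 x * (0 : R) = 0
  simp

variable (R) in
/-- The free contramodule `R[[X]]`. -/
abbrev free (X : Type u) : Contramodule R where
  carrier := FormalSum R X
  act := join
  act_point := join_point
  act_join := join_join

/-- The contraaction as a surjective morphism onto `P` from the free contramodule spanned by the
underlying set of `P`. -/
def cover (P : Contramodule R) : free R P ⟶ P where
  toFun := P.act
  map_act := P.act_join

/-- The kernel of a morphism of contramodules. -/
def ker (f : P ⟶ Q) : Contramodule R where
  carrier := {p : P // f.toFun p = 0}
  act r := ⟨P.act (map Subtype.val r), by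
    have h : f.toFun ∘ (Subtype.val : {p : P // f.toFun p = 0} → P) = fun _ => 0 :=
      funext fun p => p.2
    rw [f.map_act, map_map, h, act_map_zero]⟩
  act_point c := Subtype.ext (by
    change P.act (map Subtype.val (point R c)) = c.1
    rw [map_point, P.act_point])
  act_join r := Subtype.ext (by
    change P.act (map Subtype.val (join r)) = P.act (map Subtype.val (map _ r))
    rw [map_join, P.act_join, map_map, map_map]
    rfl)

/-- The inclusion of the kernel. -/
def kerι (f : P ⟶ Q) : ker f ⟶ P where
  toFun := Subtype.val
  map_act _ := rfl

end Contramodule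

end

/-! ### Discrete right modules and the contratensor product -/

section

variable {R : Type u} [Ring R] [UniformSpace R] [IsUniformAddGroup R] [IsTopologicalRing R]
  [IsLinearTopology Rᵐᵒᵖ R] [T2Space R] [CompleteSpace R]

open Contramodule

variable (R) in
/-- A right `R`-module is discrete if the annihilator of each of its elements is open in `R`. -/
class IsDiscreteModule (N : Type u) [AddCommGroup N] [Module Rᵐᵒᵖ N] : Prop where
  isOpen_annihilator : ∀ b : N, IsOpen {r : R | MulOpposite.op r • b = 0}

variable (N : Type u) [AddCommGroup N] [Module Rᵐᵒᵖ N] [IsDiscreteModule R N]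

variable {N} in
theorem finite_smul_ne_zero {X : Type u} (b : N) (r : FormalSum R X) :
    {x | MulOpposite.op (r.1 x) • b ≠ 0}.Finite := by
  have h : {a : R | MulOpposite.op a • b = 0} ∈ 𝓝 (0 : R) :=
    (IsDiscreteModule.isOpen_annihilator b).mem_nhds (by simp)
  exact r.2 h

variable {N} in
theorem tsum_smul {X : Type u} (b : N) (r : X → R) (hr : Summable r) (S : Finset X)
    (hS : ∀ x ∉ S, MulOpposite.op (r x) • b = 0) :
    MulOpposite.op (∑' x, r x) • b = ∑ x ∈ S, MulOpposite.op (r x) • b := by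
  letI : TopologicalSpace N := ⊥
  haveI : DiscreteTopology N := ⟨rfl⟩
  let φ : R →+ N :=
    { toFun := fun a => MulOpposite.op a • b
      map_zero' := by simp
      map_add' := fun a c => by rw [MulOpposite.op_add, add_smul] }
  have hφ : Continuous φ := by
    refine continuous_of_continuousAt_zero φ ?_
    rw [ContinuousAt, map_zero, nhds_discrete N, Filter.tendsto_pure]
    exact (IsDiscreteModule.isOpen_annihilator b).mem_nhds (by simp)
  have h1 : HasSum (fun x => φ (r x)) (φ (∑' x, r x)) := hr.hasSum.map φ hφ
  exact h1.unique (hasSum_sum_of_ne_finset_zero hS)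

/-- The element `∑ b r_p ⊗ p` of `N ⊗ P`; the sum is finite, as `N` is discrete. -/
def smulSum (P : Contramodule R) (b : N) (r : FormalSum R P) : N ⊗[ℤ] P :=
  ∑ᶠ p : P, (MulOpposite.op (r.1 p) • b) ⊗ₜ[ℤ] p

theorem smulSum_eq (P : Contramodule R) (b : N) (r : FormalSum R P) (S : Finset P)
    (hS : ∀ p ∉ S, MulOpposite.op (r.1 p) • b = 0) :
    smulSum N P b r = ∑ p ∈ S, (MulOpposite.op (r.1 p) • b) ⊗ₜ[ℤ] p := by
  refine finsum_eq_sum_of_support_subset _ fun p hp => ?_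
  by_contra hpS
  exact hp (by simp only [hS p hpS, TensorProduct.zero_tmul])

/-- The image of the difference of the two maps `N ⊗ R[[P]] ⇉ N ⊗ P` (it is generated by the images
of the elements `b ⊗ r`). -/
def contratensorRel (P : Contramodule R) : AddSubgroup (N ⊗[ℤ] P) :=
  AddSubgroup.closure
    {t | ∃ (b : N) (r : FormalSum R P), t = b ⊗ₜ[ℤ] P.act r - smulSum N P b r}

/-- The contratensor product of a discrete right `R`-module `N` and a left `R`-contramodule `P`. -/
abbrev Contratensor (P : Contramodule R) : Type u := (N ⊗[ℤ] P) ⧸ contratensorRel N P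

variable {P Q : Contramodule R}

theorem lTensor_smulSum (f : P ⟶ Q) (b : N) (r : FormalSum R P) :
    f.toAddMonoidHom.toIntLinearMap.lTensor N (smulSum N P b r)
      = smulSum N Q b (map f.toFun r) := by
  classical
  set S := (finite_smul_ne_zero b r).toFinset with hSdef
  have hS : ∀ p ∉ S, MulOpposite.op (r.1 p) • b = 0 := fun p hp => by
    by_contra h
    exact hp (by rw [hSdef, Set.Finite.mem_toFinset]; exact h)
  have key : ∀ q : Q, MulOpposite.op ((map f.toFun r).1 q) • b
      = ∑ p ∈ S with f.toFun p = q, MulOpposite.op (r.1 p) • b := fun q => by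
    change MulOpposite.op (∑' x : {x : P // f.toFun x = q}, r.1 x) • b = _
    rw [tsum_smul b (fun x : {x : P // f.toFun x = q} => r.1 x)
      (r.summable.comp_injective Subtype.val_injective) (S.subtype _)
      (fun x hx => hS x fun h => hx (by simpa using h)), Finset.sum_subtype_eq_sum_filter
        (f := fun p : P => MulOpposite.op (r.1 p) • b)]
  rw [smulSum_eq N P b r S hS, smulSum_eq N Q b (map f.toFun r) (S.image f.toFun)]
  · rw [map_sum]
    simp only [LinearMap.lTensor_tmul, key, TensorProduct.sum_tmul]
    rw [← Finset.sum_fiberwise_of_maps_to (g := f.toFun) (t := S.image f.toFun)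
      (fun p hp => Finset.mem_image_of_mem _ hp)]
    refine Finset.sum_congr rfl fun q _ => Finset.sum_congr rfl fun p hp => ?_
    rw [← (Finset.mem_filter.1 hp).2]
    rfl
  · intro q hq
    rw [key, Finset.filter_eq_empty_iff.2, Finset.sum_empty]
    intro p hp hpq
    exact hq (hpq ▸ Finset.mem_image_of_mem _ hp)

/-- Functoriality of the contratensor product in the contramodule. -/
def contratensorMap (f : P ⟶ Q) : Contratensor N P →+ Contratensor N Q :=
  QuotientAddGroup.map _ _
    (f.toAddMonoidHom.toIntLinearMap.lTensor N).toAddMonoidHom (by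
      rw [contratensorRel, AddSubgroup.closure_le]
      rintro _ ⟨b, r, rfl⟩
      refine AddSubgroup.subset_closure ⟨b, map f.toFun r, ?_⟩
      rw [← lTensor_smulSum, ← f.map_act]
      exact map_sub (f.toAddMonoidHom.toIntLinearMap.lTensor N) _ _)

/-! ### The derived functor of the contratensor product -/

/-- The syzygies of `F` in its standard free resolution. -/
def syzygy (F : Contramodule R) : ℕ → Contramodule R
  | 0 => F
  | n + 1 => ker (cover (syzygy F n))

/-- The standard resolution of `F` by free (hence projective) contramodules:
`⋯ → R[[Ω²F]] → R[[ΩF]] → R[[F]] → F → 0`, where `ΩC` is the kernel of `R[[C]] → C`. -/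
abbrev resolution (F : Contramodule R) (n : ℕ) : Contramodule R := free R (syzygy F n)

/-- The differential of the standard resolution. -/
def resolutionD (F : Contramodule R) (n : ℕ) : resolution F (n + 1) ⟶ resolution F n :=
  cover (syzygy F (n + 1)) ≫ kerι (cover (syzygy F n))

/-- The differential of the complex obtained by applying the contratensor product with `N` to the
standard resolution of `F`. -/
def ctrTorD (F : Contramodule R) (n : ℕ) :
    Contratensor N (resolution F (n + 1)) →+ Contratensor N (resolution F n) :=
  contratensorMap N (resolutionD F n)

/-- `Ctrtor_i^R(N, F)`: the left derived functors of the contratensor product in its contramodule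
argument, i.e. the homology groups of the contratensor product of `N` with a projective resolution
of `F`. -/
def CtrTor (F : Contramodule R) : ℕ → Type u
  | 0 => Contratensor N (resolution F 0) ⧸ (ctrTorD N F 0).range
  | n + 1 => (ctrTorD N F n).ker ⧸ (ctrTorD N F (n + 1)).range.addSubgroupOf (ctrTorD N F n).ker

/-- `F` is `n`-strictly flat if `Ctrtor_i^R(N, F) = 0` for all discrete right `R`-modules `N` and
all `0 < i ≤ n`. -/
def IsStrictlyFlat (n : ℕ) (F : Contramodule R) : Prop :=
  ∀ (N : Type u) [AddCommGroup N] [Module Rᵐᵒᵖ N] [IsDiscreteModule R N] (i : ℕ),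
    0 < i → i ≤ n → Subsingleton (CtrTor N F i)

end

end Contra

end

noncomputable section

namespace Contra

variable {R : Type u} [Ring R] [UniformSpace R] [IsUniformAddGroup R] [IsTopologicalRing R]
  [IsLinearTopology Rᵐᵒᵖ R] [T2Space R] [CompleteSpace R]

namespace Contramodule

variable {P Q T : Contramodule R} {X Y : Type u}

/-! ### Morphisms of contramodules -/

/-! By right exactness of the contratensor product, the first derived functor vanishes on `F`
exactly when `N ⊙ K → N ⊙ R[[F]]` is injective, `K` being the kernel of `R[[F]] → F`
(`subsingleton_ctrTor_one_iff`). Any other free presentation tests the same property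
(`KernelPure.of_free`).

A colimit is presented by the free contramodule on the elements of all terms. Its kernel is a
quotient of a free contramodule on the relations that hold at single indices
(`relations_surjective_and_pres_surjective`). Elements of this kernel may be infinite combinations
of relations, but after applying `N ⊙ -` only finitely many relations matter
(`contratensor_free_induction`), so directedness brings them to one index `x`
(`exists_contratensorMap_kerIncl_eq`).

The term at `x` is presented by elements of index at most `x`, so its free contramodule is a direct
summand of the big one. A class dying in the big one therefore dies already at `x`, and flatness of
that term makes it zero. -/

theorem id_toFun (p : P) : Hom.toFun (𝟙 P) p = p := rfl

theorem comp_toFun (f : P ⟶ Q) (g : Q ⟶ T) (p : P) :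
    Hom.toFun (f ≫ g) p = g.toFun (f.toFun p) := rfl

theorem hom_ext {f g : P ⟶ Q} (h : ∀ p, f.toFun p = g.toFun p) : f = g :=
  Hom.ext (funext h)

theorem hom_zero (f : P ⟶ Q) : f.toFun 0 = 0 := f.toAddMonoidHom.map_zero

theorem hom_sub (f : P ⟶ Q) (a b : P) : f.toFun (a - b) = f.toFun a - f.toFun b :=
  f.toAddMonoidHom.map_sub a b

theorem act_sub (r s : FormalSum R P) : P.act (r - s) = P.act r - P.act s := by
  rw [sub_eq_add_neg, act_add, act_neg, ← sub_eq_add_neg]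

theorem map_surjective {f : X → Y} (hf : Function.Surjective f) :
    Function.Surjective (map (R := R) f) := fun r =>
  ⟨map (Function.surjInv hf) r, by
    rw [map_map, (Function.rightInverse_surjInv hf).comp_eq_id, map_id]⟩

theorem act_map_act (t : X → FormalSum R P) (r : FormalSum R X) :
    P.act (map (fun x => P.act (t x)) r) = P.act (bind t r) := by
  have h : bind t r = join (map t r) := by
    simp only [map_eq_bind, join_eq_bind, bind_bind, bind_point, id]
  rw [h, P.act_join, map_map]
  rfl

theorem bind_sub (g h : X → FormalSum R Y) (r : FormalSum R X) :
    bind (fun x => g x - h x) r = bind g r - bind h r := by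
  ext y
  change ∑' x, r.1 x * ((g x).1 y - (h x).1 y) = ∑' x, r.1 x * (g x).1 y - ∑' x, r.1 x * (h x).1 y
  simp only [mul_sub]
  exact (summable_mul r fun x => (g x).1 y).tsum_sub (summable_mul r fun x => (h x).1 y)

/-- Subtraction is itself a contraaction, of `point R (a x) - point R (b x)`. By associativity the
claim reduces to additivity of substitution in the substituted family. -/
theorem act_map_sub (a b : X → P) (r : FormalSum R X) :
    P.act (map (fun x => a x - b x) r) = P.act (map a r) - P.act (map b r) := by
  have h : (fun x => a x - b x) = fun x => P.act (point R (a x) - point R (b x)) := by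
    funext x
    rw [act_sub, act_point, act_point]
  rw [h, act_map_act, bind_sub, act_sub, map_eq_bind, map_eq_bind]

/-- The difference of two morphisms of contramodules. -/
def homSub (f g : P ⟶ Q) : P ⟶ Q where
  toFun p := f.toFun p - g.toFun p
  map_act r := by rw [act_map_sub, f.map_act, g.map_act]

theorem homSub_toFun (f g : P ⟶ Q) (p : P) : (homSub f g).toFun p = f.toFun p - g.toFun p := rfl

theorem homSub_toFun_of_eq_zero (f g : P ⟶ Q) {p : P} (h : g.toFun p = 0) :
    (homSub f g).toFun p = f.toFun p := by
  rw [homSub_toFun, h, sub_zero]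

/-- The morphism into the kernel of `g` defined by a morphism annihilated by `g`. -/
def kerLift (g : P ⟶ Q) (f : T ⟶ P) (h : ∀ t, g.toFun (f.toFun t) = 0) : T ⟶ ker g where
  toFun t := ⟨f.toFun t, h t⟩
  map_act r := Subtype.ext (by
    change f.toFun (T.act r) = P.act (map Subtype.val (map _ r))
    rw [map_map, f.map_act]
    rfl)

theorem kerι_kerLift (g : P ⟶ Q) (f : T ⟶ P) (h : ∀ t, g.toFun (f.toFun t) = 0) (t : T) :
    (kerι g).toFun ((kerLift g f h).toFun t) = f.toFun t := rfl

theorem ker_ext {f : P ⟶ Q} {a b : ker f} (h : (kerι f).toFun a = (kerι f).toFun b) : a = b :=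
  Subtype.ext h

theorem kerι_mem (f : P ⟶ Q) (a : ker f) : f.toFun ((kerι f).toFun a) = 0 := a.2

/-- The morphism of kernels induced by a commutative square. -/
def kerMap {P' Q' : Contramodule R} (f : P ⟶ Q) (f' : P' ⟶ Q') (a : P ⟶ P') (b : Q ⟶ Q')
    (h : a ≫ f' = f ≫ b) : ker f ⟶ ker f' :=
  kerLift f' (kerι f ≫ a) fun t => by
    rw [← comp_toFun, Category.assoc, h, comp_toFun, comp_toFun, kerι_mem, hom_zero]

theorem kerMap_kerι {P' Q' : Contramodule R} (f : P ⟶ Q) (f' : P' ⟶ Q') (a : P ⟶ P')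
    (b : Q ⟶ Q') (h : a ≫ f' = f ≫ b) : kerMap f f' a b h ≫ kerι f' = kerι f ≫ a := rfl

/-- The morphism from a free contramodule defined by the images of the generators. -/
def freeLift (g : X → P) : free R X ⟶ P where
  toFun r := P.act (map g r)
  map_act r := by
    change P.act (map g (join r)) = _
    rw [map_join, P.act_join, map_map]
    rfl

theorem freeLift_point (g : X → P) (x : X) : (freeLift g).toFun (point R x) = g x := by
  change P.act (map g (point R x)) = g x
  rw [map_point, P.act_point]

theorem free_hom_ext {f g : free R X ⟶ P} (h : ∀ x, f.toFun (point R x) = g.toFun (point R x)) :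
    f = g := by
  refine hom_ext fun r => ?_
  have hr : r = (free R X).act (map (point R) r) := (join_map_point r).symm
  rw [hr, f.map_act, g.map_act, map_map, map_map]
  congr 2
  exact congrArg _ (funext h)

/-- The morphism of free contramodules induced by a map of sets. -/
def freeMap (f : X → Y) : free R X ⟶ free R Y := freeLift (P := free R Y) fun x => point R (f x)

theorem freeMap_point (f : X → Y) (x : X) :
    (freeMap (R := R) f).toFun (point R x) = point R (f x) :=
  freeLift_point (P := free R Y) _ x

theorem cover_point (p : P) : (cover P).toFun (point R p) = p := P.act_point p

/-- A morphism from a free contramodule lifts along a surjective morphism. -/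
theorem exists_lift (f : free R X ⟶ Q) (g : P ⟶ Q) (hg : Function.Surjective g.toFun) :
    ∃ h : free R X ⟶ P, h ≫ g = f := by
  refine ⟨freeLift fun x => Function.surjInv hg (f.toFun (point R x)), free_hom_ext fun x => ?_⟩
  rw [comp_toFun, freeLift_point, Function.surjInv_eq hg]

/-! ### Cokernels -/

/-- The class of an element modulo the image of `g`. -/
def cokerMk (g : P ⟶ Q) (q : Q) : Q ⧸ g.toAddMonoidHom.range := QuotientAddGroup.mk q

/-- A representative of a class modulo the image of `g`. -/
def cokerOut (g : P ⟶ Q) (c : Q ⧸ g.toAddMonoidHom.range) : Q := Quotient.out c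

theorem cokerMk_cokerOut (g : P ⟶ Q) (c : Q ⧸ g.toAddMonoidHom.range) :
    cokerMk g (cokerOut g c) = c := QuotientAddGroup.out_eq' c

theorem cokerMk_eq_iff (g : P ⟶ Q) (a b : Q) :
    cokerMk g a = cokerMk g b ↔ ∃ p, g.toFun p = a - b := by
  rw [eq_comm]
  refine (QuotientAddGroup.eq (s := g.toAddMonoidHom.range)).trans ?_
  rw [neg_add_eq_sub]
  rfl

/-- The image of `g` is closed under infinite combinations: choose preimages of the differences
between elements and their representatives, and combine these preimages with the same coefficients.
Hence the contraaction descends to the quotient. -/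
theorem cokerMk_act (g : P ⟶ Q) (r : FormalSum R Q) :
    cokerMk g (Q.act r) = cokerMk g (Q.act (map (cokerOut g) (map (cokerMk g) r))) := by
  have hd (q : Q) : ∃ p : P, g.toFun p = q - cokerOut g (cokerMk g q) := by
    rw [← cokerMk_eq_iff, cokerMk_cokerOut]
  choose p hp using hd
  refine (cokerMk_eq_iff g _ _).2 ⟨P.act (map p r), ?_⟩
  have hp' : g.toFun ∘ p = _ := funext hp
  rw [g.map_act, map_map, map_map, hp', act_map_sub]
  congr 2
  exact map_id r

/-- The cokernel of a morphism of contramodules. -/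
def coker (g : P ⟶ Q) : Contramodule R where
  carrier := Q ⧸ g.toAddMonoidHom.range
  act r := cokerMk g (Q.act (map (cokerOut g) r))
  act_point c := by rw [map_point, Q.act_point, cokerMk_cokerOut]
  act_join r := by
    have hout : cokerMk g ∘ cokerOut g = id := funext (cokerMk_cokerOut g)
    -- `r` is replaced by its lift to formal sums of formal sums in `Q`, where associativity is
    -- available.
    have hr : map (map (cokerMk g)) (map (map (cokerOut g)) r) = r := by
      have h : (map (R := R) (cokerMk g)) ∘ map (cokerOut g) = id := funext fun s => by
        rw [Function.comp_apply, map_map, hout, map_id, id]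
      rw [map_map, h, map_id]
    have hl := cokerMk_act g (join (map (map (cokerOut g)) r))
    rw [map_join, hr, Q.act_join, cokerMk_act g (map Q.act _), map_map, map_map] at hl
    rw [← hl, map_map]
    exact congrArg (fun t => cokerMk g (Q.act t))
      (map_map (fun s => cokerMk g (Q.act (map (cokerOut g) s))) (cokerOut g) r).symm

/-- The projection onto the cokernel. -/
def cokerπ (g : P ⟶ Q) : Q ⟶ coker g where
  toFun := cokerMk g
  map_act r := cokerMk_act g r

theorem cokerπ_eq_zero_iff (g : P ⟶ Q) (a : Q) :
    (cokerπ g).toFun a = 0 ↔ ∃ p, g.toFun p = a := by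
  rw [← hom_zero (cokerπ g)]
  refine (cokerMk_eq_iff g a 0).trans ?_
  rw [sub_zero]

theorem cokerπ_surjective (g : P ⟶ Q) : Function.Surjective (cokerπ g).toFun :=
  QuotientAddGroup.mk_surjective

/-- The morphism from the cokernel of `g` defined by a morphism annihilating the image of `g`. -/
def cokerDesc (g : P ⟶ Q) (f : Q ⟶ T) (h : ∀ p, f.toFun (g.toFun p) = 0) : coker g ⟶ T where
  toFun := QuotientAddGroup.lift g.toAddMonoidHom.range f.toAddMonoidHom (by
    rintro _ ⟨p, rfl⟩
    exact h p)
  map_act r := by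
    change f.toFun (Q.act (map (cokerOut g) r)) = _
    rw [f.map_act]
    refine congrArg T.act ((map_map _ _ r).trans (congrArg (fun t => map t r) (funext fun c => ?_)))
    conv_rhs => rw [← cokerMk_cokerOut g c]
    rfl

theorem cokerπ_cokerDesc (g : P ⟶ Q) (f : Q ⟶ T) (h : ∀ p, f.toFun (g.toFun p) = 0) :
    cokerπ g ≫ cokerDesc g f h = f := rfl

end Contramodule

open Contramodule

section

variable (N : Type u) [AddCommGroup N] [Module Rᵐᵒᵖ N] [IsDiscreteModule R N]
  {P Q T : Contramodule R} {X Y : Type u}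

/-! ### Right exactness of the contratensor product -/

/-- The class of a decomposable tensor in the contratensor product. -/
def ctmul (P : Contramodule R) (b : N) (p : P) : Contratensor N P :=
  QuotientAddGroup.mk (b ⊗ₜ[ℤ] p)

theorem contratensorMap_ctmul (f : P ⟶ Q) (b : N) (p : P) :
    contratensorMap N f (ctmul N P b p) = ctmul N Q b (f.toFun p) := rfl

theorem contratensor_induction {C : Contratensor N P → Prop} (z : Contratensor N P)
    (zero : C 0) (tmul : ∀ b p, C (ctmul N P b p)) (add : ∀ x y, C x → C y → C (x + y)) :
    C z := by
  induction z using QuotientAddGroup.induction_on with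
  | H t =>
    induction t using TensorProduct.induction_on with
    | zero => exact zero
    | tmul b p => exact tmul b p
    | add x y hx hy => exact add _ _ hx hy

theorem contratensorMap_id (z : Contratensor N P) : contratensorMap N (𝟙 P) z = z := by
  induction z using contratensor_induction with
  | zero => exact map_zero _
  | tmul b p => rfl
  | add x y hx hy => rw [map_add, hx, hy]

theorem contratensorMap_comp (f : P ⟶ Q) (g : Q ⟶ T) (z : Contratensor N P) :
    contratensorMap N (f ≫ g) z = contratensorMap N g (contratensorMap N f z) := by
  induction z using contratensor_induction with
  | zero => simp only [map_zero]
  | tmul b p => rfl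
  | add x y hx hy => simp only [map_add, hx, hy]

theorem contratensorMap_homSub (f g : P ⟶ Q) (z : Contratensor N P) :
    contratensorMap N (homSub f g) z = contratensorMap N f z - contratensorMap N g z := by
  induction z using contratensor_induction with
  | zero => simp only [map_zero, sub_zero]
  | tmul b p =>
    simp only [contratensorMap_ctmul]
    change QuotientAddGroup.mk (b ⊗ₜ[ℤ] (f.toFun p - g.toFun p)) = _
    rw [TensorProduct.tmul_sub]
    rfl
  | add x y hx hy => simp only [map_add, hx, hy]; abel

theorem contratensorMap_surjective (f : P ⟶ Q) (hf : Function.Surjective f.toFun) :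
    Function.Surjective (contratensorMap N f) := fun z => by
  induction z using contratensor_induction with
  | zero => exact ⟨0, map_zero _⟩
  | tmul b q =>
    obtain ⟨p, rfl⟩ := hf q
    exact ⟨ctmul N P b p, rfl⟩
  | add x y hx hy =>
    obtain ⟨x, rfl⟩ := hx
    obtain ⟨y, rfl⟩ := hy
    exact ⟨x + y, map_add _ _ _⟩

/-- Exactness in the middle follows from right exactness of the ordinary tensor product over the
integers, once the relations defining the contratensor product are corrected for. -/
theorem exists_of_contratensorMap_eq_zero (f : P ⟶ Q) (hf : Function.Surjective f.toFun)
    (z : Contratensor N P) (hz : contratensorMap N f z = 0) :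
    ∃ w, contratensorMap N (kerι f) w = z := by
  induction z using QuotientAddGroup.induction_on with
  | H t =>
    have ht : f.toAddMonoidHom.toIntLinearMap.lTensor N t ∈ contratensorRel N Q :=
      (QuotientAddGroup.eq_zero_iff _).1 hz
    -- Relations lift along `f` because formal sums over `Q` lift to formal sums over `P`.
    have hlift : ∀ s ∈ contratensorRel N Q, ∃ r ∈ contratensorRel N P,
        f.toAddMonoidHom.toIntLinearMap.lTensor N r = s := by
      intro s hs
      induction hs using AddSubgroup.closure_induction with
      | mem s hs =>
        obtain ⟨b, r, rfl⟩ := hs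
        obtain ⟨r, rfl⟩ := map_surjective hf r
        refine ⟨_, AddSubgroup.subset_closure ⟨b, r, rfl⟩, ?_⟩
        rw [← lTensor_smulSum, ← f.map_act]
        exact map_sub (f.toAddMonoidHom.toIntLinearMap.lTensor N) _ _
      | zero => exact ⟨0, zero_mem _, map_zero _⟩
      | add x y _ _ hx hy =>
        obtain ⟨x, hx, rfl⟩ := hx
        obtain ⟨y, hy, rfl⟩ := hy
        exact ⟨x + y, add_mem hx hy, map_add _ _ _⟩
      | neg x _ hx =>
        obtain ⟨x, hx, rfl⟩ := hx
        exact ⟨-x, neg_mem hx, map_neg _ _⟩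
    obtain ⟨r, hr, hrt⟩ := hlift _ ht
    have hex : Function.Exact (kerι f).toAddMonoidHom.toIntLinearMap
        f.toAddMonoidHom.toIntLinearMap := fun p =>
      ⟨fun hp => ⟨⟨p, hp⟩, rfl⟩, by rintro ⟨a, rfl⟩; exact kerι_mem f a⟩
    have h0 : f.toAddMonoidHom.toIntLinearMap.lTensor N (t - r) = 0 := by
      rw [map_sub, hrt, sub_self]
    obtain ⟨w, hw⟩ := (lTensor_exact N hex hf (t - r)).1 h0
    refine ⟨QuotientAddGroup.mk w, ?_⟩
    change QuotientAddGroup.mk ((kerι f).toAddMonoidHom.toIntLinearMap.lTensor N w) = _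
    rw [hw]
    refine (QuotientAddGroup.eq.2 ?_)
    rw [neg_sub, sub_add_cancel]
    exact hr

/-- Writing `p` as the contraaction on the point measures, the defining relation turns `b ⊗ p` into
a finite sum of terms `b p_x ⊗ x`. Infinite combinations thus disappear after contratensoring. -/
theorem contratensor_free_induction {C : Contratensor N (free R X) → Prop}
    (z : Contratensor N (free R X)) (zero : C 0)
    (tmul : ∀ b x, C (ctmul N (free R X) b (point R x)))
    (add : ∀ x y, C x → C y → C (x + y)) : C z := by
  classical
  induction z using contratensor_induction with
  | zero => exact zero
  | add x y hx hy => exact add x y hx hy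
  | tmul b p =>
    have hp : p = (free R X).act (map (point R) p) := (join_map_point p).symm
    have h : ctmul N (free R X) b p
        = QuotientAddGroup.mk (smulSum N (free R X) b (map (point R) p)) := by
      refine QuotientAddGroup.eq.2 ?_
      rw [neg_add_eq_sub, ← neg_sub, neg_mem_iff]
      nth_rw 1 [hp]
      exact AddSubgroup.subset_closure ⟨b, _, rfl⟩
    rw [h, smulSum]
    refine finsum_induction (p := fun t => C (QuotientAddGroup.mk t)) zero
      (fun x y hx hy => add _ _ hx hy) fun q => ?_
    by_cases hq : ∃ x, point R x = q
    · obtain ⟨x, rfl⟩ := hq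
      exact tmul _ x
    -- Off the point measures the coefficient is a sum over an empty fibre.
    · have h0 : (map (point R) p).1 q = 0 := by
        change ∑' x : {x : X // point R x = q}, p.1 x = 0
        haveI : IsEmpty {x : X // point R x = q} := ⟨fun x => hq ⟨x.1, x.2⟩⟩
        exact tsum_empty
      rw [h0, MulOpposite.op_zero, zero_smul, TensorProduct.zero_tmul]
      exact zero

/-! ### Flatness in terms of presentations -/

/-- The contratensor product with `N` preserves injectivity of the inclusion of the kernel of `f`. -/
def KernelPure (f : P ⟶ Q) : Prop :=
  ∀ z, contratensorMap N (kerι f) z = 0 → z = 0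

variable {N}

/-- A comparison argument: with lifts `a`, `b` of the identity of `F`, the map `1 - b ≫ a` on `free
R Y` lands in `ker g`, so on `ker g` the map `1 - b' ≫ a'` factors through the inclusion `kerι g`. A
class `z` killed by that inclusion therefore equals the image under `a'` of `b' z`, and `b' z`
vanishes by purity for `f`. -/
theorem KernelPure.of_free {F : Contramodule R} {f : free R X ⟶ F} {g : free R Y ⟶ F}
    (hf : Function.Surjective f.toFun) (hg : Function.Surjective g.toFun)
    (h : KernelPure N f) : KernelPure N g := by
  intro z hz
  obtain ⟨a, ha⟩ := exists_lift f g hg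
  obtain ⟨b, hb⟩ := exists_lift g f hf
  let a' := kerMap f g a (𝟙 F) (by rw [ha, Category.comp_id])
  let b' := kerMap g f b (𝟙 F) (by rw [hb, Category.comp_id])
  let e : free R Y ⟶ ker g := kerLift g (homSub (𝟙 _) (b ≫ a)) fun t => by
    rw [homSub_toFun, hom_sub, comp_toFun, ← comp_toFun a g, ha, ← comp_toFun b f, hb, id_toFun,
      sub_self]
  have he : contratensorMap N (homSub (𝟙 _) (b' ≫ a')) z = contratensorMap N (kerι g ≫ e) z := by
    congr 2
    refine hom_ext fun t => ker_ext ?_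
    rw [homSub_toFun, hom_sub, comp_toFun]
    rfl
  have hb0 : contratensorMap N b' z = 0 := by
    apply h
    rw [← contratensorMap_comp, kerMap_kerι, contratensorMap_comp, hz, map_zero]
  rw [contratensorMap_homSub, contratensorMap_id, contratensorMap_comp, hb0, map_zero, sub_zero,
    contratensorMap_comp, hz, map_zero] at he
  exact he

/-- A section `s` of the cover splits off the kernel: `1 - cover P ≫ s` is a retraction onto it, and
retractions survive any functor. -/
theorem kernelPure_cover_of_projective (P : Contramodule R) [Projective P] :
    KernelPure N (cover P) := by
  intro z hz
  haveI : Epi (cover P) := ⟨fun g h hgh => hom_ext fun p => by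
    have := congrArg (fun k => Hom.toFun k (point R p)) hgh
    simpa only [comp_toFun, cover_point] using this⟩
  let s : P ⟶ free R P := Projective.factorThru (𝟙 P) (cover P)
  have hs : s ≫ cover P = 𝟙 P := Projective.factorThru_comp _ _
  let e : free R P ⟶ ker (cover P) := kerLift _ (homSub (𝟙 _) (cover P ≫ s)) fun t => by
    rw [homSub_toFun, hom_sub, id_toFun, comp_toFun, ← comp_toFun s, hs, id_toFun, sub_self]
  have he : kerι (cover P) ≫ e = 𝟙 _ := hom_ext fun t => ker_ext (by
    rw [comp_toFun, kerι_kerLift, homSub_toFun_of_eq_zero]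
    · rfl
    · rw [comp_toFun, kerι_mem, hom_zero])
  rw [← contratensorMap_id N z, ← he, contratensorMap_comp, hz, map_zero]

variable (N) in
theorem ctrTorD_apply (F : Contramodule R) (n : ℕ) (w : Contratensor N (resolution F (n + 1))) :
    ctrTorD N F n w = contratensorMap N (kerι (cover (syzygy F n)))
      (contratensorMap N (cover (syzygy F (n + 1))) w) :=
  contratensorMap_comp N (cover (syzygy F (n + 1))) (kerι (cover (syzygy F n))) w

variable (N) in
theorem contratensorMap_kerι (f : P ⟶ Q) (w : Contratensor N (ker f)) :
    contratensorMap N f (contratensorMap N (kerι f) w) = 0 := by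
  induction w using contratensor_induction with
  | zero => simp only [map_zero]
  | add x y hx hy => rw [map_add, map_add, hx, hy, add_zero]
  | tmul b p =>
    rw [contratensorMap_ctmul, contratensorMap_ctmul, kerι_mem, ctmul, TensorProduct.tmul_zero]
    rfl

variable (N) in
-- Each differential factors as a surjection onto the contratensor product with a syzygy, followed
-- by the map induced by the syzygy inclusion. By right exactness the boundaries in degree one are
-- the kernel of the first factor, so the homology is the kernel of the second.
theorem subsingleton_ctrTor_one_iff (F : Contramodule R) :
    Subsingleton (CtrTor N F 1) ↔ KernelPure N (cover F) := by
  have hrange (w) : w ∈ (ctrTorD N F 1).range ↔ contratensorMap N (cover (syzygy F 1)) w = 0 := by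
    constructor
    · rintro ⟨v, rfl⟩
      rw [ctrTorD_apply]
      exact contratensorMap_kerι N (cover (syzygy F 1)) _
    · intro hw
      obtain ⟨v, rfl⟩ := exists_of_contratensorMap_eq_zero N _ (act_surjective _) w hw
      obtain ⟨v, rfl⟩ := contratensorMap_surjective N (cover (syzygy F 2)) (act_surjective _) v
      exact ⟨v, ctrTorD_apply N F 1 v⟩
  rw [CtrTor, QuotientAddGroup.subsingleton_iff, AddSubgroup.addSubgroupOf_eq_top]
  constructor
  · intro h z hz
    obtain ⟨w, rfl⟩ := contratensorMap_surjective N (cover (syzygy F 1)) (act_surjective _) z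
    refine (hrange w).1 (h ?_)
    rw [AddMonoidHom.mem_ker, ctrTorD_apply]
    exact hz
  · intro h w hw
    rw [AddMonoidHom.mem_ker, ctrTorD_apply] at hw
    exact (hrange w).2 (h _ hw)

variable (R) in
theorem isStrictlyFlat_one_iff (F : Contramodule R) :
    IsStrictlyFlat 1 F ↔ ∀ (N : Type u) [AddCommGroup N] [Module Rᵐᵒᵖ N] [IsDiscreteModule R N],
      KernelPure N (cover F) := by
  constructor
  · intro h N _ _ _
    exact (subsingleton_ctrTor_one_iff N F).1 (h N 1 one_pos le_rfl)
  · intro h N _ _ _ i hi hi'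
    obtain rfl : i = 1 := le_antisymm hi' hi
    exact (subsingleton_ctrTor_one_iff N F).2 (h N)

end

/-! ### Factorization through surjective morphisms -/

theorem Contramodule.exists_factor {P Q T : Contramodule R} (f : P ⟶ Q)
    (hf : Function.Surjective f.toFun) (h : P ⟶ T) (hk : ∀ p, f.toFun p = 0 → h.toFun p = 0) :
    ∃ k : Q ⟶ T, f ≫ k = h := by
  have key (p : P) : h.toFun (Function.surjInv hf (f.toFun p)) = h.toFun p := by
    rw [← sub_eq_zero, ← hom_sub]
    refine hk _ ?_
    rw [hom_sub, Function.surjInv_eq hf, sub_self]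
  refine ⟨⟨fun q => h.toFun (Function.surjInv hf q), fun r => ?_⟩, hom_ext key⟩
  obtain ⟨r, rfl⟩ := map_surjective hf r
  rw [← f.map_act, key, h.map_act, map_map]
  exact congrArg (fun t => T.act (map t r)) (funext fun p => (key p).symm)

theorem Contramodule.cancel_surjective {P Q T : Contramodule R} (f : P ⟶ Q)
    (hf : Function.Surjective f.toFun) {k l : Q ⟶ T} (h : f ≫ k = f ≫ l) : k = l := by
  refine hom_ext fun q => ?_
  obtain ⟨p, rfl⟩ := hf q
  rw [← comp_toFun, h, comp_toFun]

/-! ### Presentations of directed colimits -/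

section Colimit

variable {X : Type u} [PartialOrder X] (F : X ⥤ Contramodule R)

/-- The elements of the contramodules of the diagram with indices at most `x`. -/
abbrev ElementsLE (x : X) : Type u := {a : Σ y, F.obj y // a.1 ≤ x}

/-- The presentation of `F.obj x` by the elements of all `F.obj y` with `y ≤ x`. -/
def presLE (x : X) : free R (ElementsLE F x) ⟶ F.obj x :=
  freeLift fun a => (F.map (homOfLE a.2)).toFun a.1.2

theorem presLE_point (x : X) (a : ElementsLE F x) :
    (presLE F x).toFun (point R a) = (F.map (homOfLE a.2)).toFun a.1.2 :=
  freeLift_point _ a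

theorem presLE_point_self (x : X) (p : F.obj x) :
    (presLE F x).toFun (point R ⟨⟨x, p⟩, le_rfl⟩) = p := by
  rw [presLE_point]
  exact congrArg (fun f => Hom.toFun f p) (F.map_id x)

theorem presLE_surjective (x : X) : Function.Surjective (presLE F x).toFun := fun p =>
  ⟨_, presLE_point_self F x p⟩

/-- The inclusion of the elements with indices at most `x` into those with indices at most `y`. -/
def inclLE {x y : X} (h : x ≤ y) : free R (ElementsLE F x) ⟶ free R (ElementsLE F y) :=
  freeMap fun a => ⟨a.1, a.2.trans h⟩

/-- The inclusion of the elements with indices at most `x` into all elements. -/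
def incl (x : X) : free R (ElementsLE F x) ⟶ free R (Σ y, F.obj y) :=
  freeMap Subtype.val

theorem inclLE_presLE {x y : X} (h : x ≤ y) :
    inclLE F h ≫ presLE F y = presLE F x ≫ F.map (homOfLE h) := by
  refine free_hom_ext fun a => ?_
  rw [comp_toFun, comp_toFun, inclLE, freeMap_point, presLE_point, presLE_point, ← comp_toFun,
    ← F.map_comp]
  rfl

theorem inclLE_incl {x y : X} (h : x ≤ y) : inclLE F h ≫ incl F y = incl F x := by
  refine free_hom_ext fun a => ?_
  rw [comp_toFun, inclLE, incl, incl, freeMap_point, freeMap_point, freeMap_point]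

/-- The split makes `incl F x` stay injective under the contratensor product. The zero of `F.obj x`
supplies the default value of the left inverse. -/
theorem exists_incl_retraction (x : X) :
    ∃ r : free R (Σ y, F.obj y) ⟶ free R (ElementsLE F x), incl F x ≫ r = 𝟙 _ := by
  haveI : Nonempty (ElementsLE F x) := ⟨⟨⟨x, 0⟩, le_rfl⟩⟩
  obtain ⟨s, hs⟩ := (Subtype.val_injective (p := fun a : Σ y, F.obj y => a.1 ≤ x)).hasLeftInverse
  refine ⟨freeMap s, free_hom_ext fun a => ?_⟩
  rw [comp_toFun, incl, freeMap_point, freeMap_point, hs a, id_toFun]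

/-! ### Relations in the vertex of a cocone -/

variable {F} (c : Cocone F)

/-- The morphism to the vertex of a cocone from the free contramodule on all elements. -/
def pres : free R (Σ y, F.obj y) ⟶ c.pt := freeLift fun a => (c.ι.app a.1).toFun a.2

theorem pres_point (a : Σ y, F.obj y) :
    (pres c).toFun (point R a) = (c.ι.app a.1).toFun a.2 := freeLift_point _ a

theorem incl_pres (x : X) : incl F x ≫ pres c = presLE F x ≫ c.ι.app x := by
  refine free_hom_ext fun a => ?_
  rw [comp_toFun, comp_toFun, incl, freeMap_point, pres_point, presLE_point, ← comp_toFun, c.w]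

/-- The relations holding at the index `x` hold in the vertex of the cocone. -/
def kerIncl (x : X) : ker (presLE F x) ⟶ ker (pres c) :=
  kerMap _ _ (incl F x) (c.ι.app x) (incl_pres c x)

theorem kerIncl_kerι (x : X) : kerIncl c x ≫ kerι (pres c) = kerι (presLE F x) ≫ incl F x := rfl

theorem exists_kerIncl_factor {x y : X} (h : x ≤ y) :
    ∃ t : ker (presLE F x) ⟶ ker (presLE F y), t ≫ kerIncl c y = kerIncl c x := by
  refine ⟨kerMap _ _ (inclLE F h) _ (inclLE_presLE F h), hom_ext fun a => ker_ext ?_⟩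
  rw [← comp_toFun, ← comp_toFun, Category.assoc, kerIncl_kerι, kerIncl_kerι, ← Category.assoc,
    kerMap_kerι, Category.assoc, inclLE_incl]

/-- The free contramodule on the relations holding at some index, mapped to the relations holding
in the vertex of the cocone. -/
def relations : free R (Σ x, ker (presLE F x)) ⟶ ker (pres c) :=
  freeLift fun s => (kerIncl c s.1).toFun s.2

theorem relations_point (s : Σ x, ker (presLE F x)) :
    (relations c).toFun (point R s) = (kerIncl c s.1).toFun s.2 := freeLift_point _ s

/-- A relation at `x` is a generator of the source of `relations c`, so it dies in the cokernel.
These morphisms form the cocone to be compared with the colimit. -/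
theorem exists_toCoker (x : X) :
    ∃ k : F.obj x ⟶ coker (relations c ≫ kerι (pres c)),
      presLE F x ≫ k = incl F x ≫ cokerπ (relations c ≫ kerι (pres c)) := by
  refine exists_factor _ (presLE_surjective F x) _ fun a ha => ?_
  rw [comp_toFun, cokerπ_eq_zero_iff]
  refine ⟨point R ⟨x, a, ha⟩, ?_⟩
  rw [comp_toFun, relations_point]
  rfl

/-! ### Directed colimits and flatness -/

variable {c} (hc : IsColimit c)
include hc

/-- The free contramodule on all elements modulo all relations from single indices is the vertex of
a cocone. Comparing it with the colimit in both directions yields both claims. -/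
theorem relations_surjective_and_pres_surjective :
    Function.Surjective (relations c).toFun ∧ Function.Surjective (pres c).toFun := by
  have hk := exists_toCoker c
  set g := relations c ≫ kerι (pres c) with hg
  choose k hk using hk
  let d : Cocone F :=
    { pt := coker g
      ι :=
        { app := k
          naturality := fun x y φ => by
            refine cancel_surjective _ (presLE_surjective F x) ?_
            have h := inclLE_presLE F (leOfHom φ)
            have hφ : homOfLE (leOfHom φ) = φ := rfl
            rw [hφ] at h
            rw [← Category.assoc, ← h, Category.assoc, hk, ← Category.assoc, inclLE_incl, ← hk]
            rfl } }
  have hd (x : X) : c.ι.app x ≫ hc.desc d = k x := hc.fac d x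
  have hq : pres c ≫ hc.desc d = cokerπ g := by
    refine free_hom_ext fun a => ?_
    have h := congrArg (fun f => Hom.toFun f (point R ⟨a, le_rfl⟩)) (hk a.1)
    simp only [comp_toFun] at h
    rw [presLE_point_self, incl, freeMap_point] at h
    rw [comp_toFun, pres_point, ← comp_toFun, hd, h]
  constructor
  · intro b
    -- The projection factors through `pres c`, so whatever `pres c` kills lies in the image of the
    -- relations.
    have hb : (cokerπ g).toFun ((kerι (pres c)).toFun b) = 0 := by
      rw [← hq, comp_toFun, kerι_mem, hom_zero]
    obtain ⟨v, hv⟩ := (cokerπ_eq_zero_iff g _).1 hb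
    exact ⟨v, ker_ext hv⟩
  · let e : coker g ⟶ c.pt := cokerDesc g (pres c) fun v => by
      rw [hg, comp_toFun, kerι_mem]
    -- Uniqueness of morphisms out of the colimit makes `e` split surjective, hence so is `pres c`
    -- surjective, being the projection followed by `e`.
    have he : hc.desc d ≫ e = 𝟙 c.pt := hc.hom_ext fun x => by
      refine cancel_surjective _ (presLE_surjective F x) ?_
      rw [← Category.assoc (c.ι.app x), hd, ← Category.assoc, hk, Category.assoc,
        cokerπ_cokerDesc, incl_pres, Category.comp_id]
    intro t
    obtain ⟨v, hv⟩ := cokerπ_surjective g ((hc.desc d).toFun t)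
    refine ⟨v, ?_⟩
    change (cokerπ g ≫ e).toFun v = t
    rw [comp_toFun, hv, ← comp_toFun, he, id_toFun]

variable [IsDirectedOrder X] {N : Type u} [AddCommGroup N] [Module Rᵐᵒᵖ N] [IsDiscreteModule R N]

/-- A class is a finite sum of terms `b ⊗ s` with `s` a relation at one index, and directedness
gives a common upper bound. The alternative `z = 0` covers an empty index poset. -/
theorem exists_contratensorMap_kerIncl_eq (z : Contratensor N (ker (pres c))) :
    z = 0 ∨ ∃ x w, contratensorMap N (kerIncl c x) w = z := by
  obtain ⟨z, rfl⟩ := contratensorMap_surjective N _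
    (relations_surjective_and_pres_surjective hc).1 z
  induction z using contratensor_free_induction with
  | zero => exact Or.inl (map_zero _)
  | tmul b s =>
    refine Or.inr ⟨s.1, ctmul N _ b s.2, ?_⟩
    rw [contratensorMap_ctmul, contratensorMap_ctmul, relations_point]
  | add v w hv hw =>
    rw [map_add]
    rcases hv with hv | ⟨x, v', hv⟩
    · rwa [hv, zero_add]
    rcases hw with hw | ⟨y, w', hw⟩
    · rw [hw, add_zero]
      exact Or.inr ⟨x, v', hv⟩
    obtain ⟨m, hxm, hym⟩ := exists_ge_ge x y
    obtain ⟨s, hs⟩ := exists_kerIncl_factor c hxm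
    obtain ⟨t, ht⟩ := exists_kerIncl_factor c hym
    refine Or.inr ⟨m, contratensorMap N s v' + contratensorMap N t w', ?_⟩
    rw [map_add, ← contratensorMap_comp, ← contratensorMap_comp, hs, ht, hv, hw]

theorem kernelPure_cover_of_isColimit (h : ∀ x, KernelPure N (cover (F.obj x))) :
    KernelPure N (cover c.pt) := by
  refine KernelPure.of_free (f := pres c) (relations_surjective_and_pres_surjective hc).2
    (act_surjective _) fun z hz => ?_
  rcases exists_contratensorMap_kerIncl_eq hc z with rfl | ⟨x, w, rfl⟩
  · rfl
  have hx : KernelPure N (presLE F x) :=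
    KernelPure.of_free (act_surjective _) (presLE_surjective F x) (h x)
  obtain ⟨r, hr⟩ := exists_incl_retraction F x
  -- It remains to see that `w` dies in the free contramodule at `x`; it does so after `incl F x`,
  -- which the retraction `r` undoes.
  rw [hx w, map_zero]
  rw [← contratensorMap_comp, kerIncl_kerι, contratensorMap_comp] at hz
  rw [← contratensorMap_id N (contratensorMap N (kerι (presLE F x)) w), ← hr, contratensorMap_comp,
    hz, map_zero]

theorem isStrictlyFlat_one_of_isColimit (h : ∀ x, IsStrictlyFlat 1 (F.obj x)) :
    IsStrictlyFlat 1 c.pt :=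
  (isStrictlyFlat_one_iff R c.pt).2 fun _ _ _ _ => kernelPure_cover_of_isColimit hc fun x =>
    (isStrictlyFlat_one_iff R (F.obj x)).1 (h x) _

end Colimit

theorem isStrictlyFlat_one_of_projective (P : Contramodule R) [Projective P] :
    IsStrictlyFlat 1 P :=
  (isStrictlyFlat_one_iff R P).2 fun _ _ _ _ => kernelPure_cover_of_projective P

end Contra

end

theorem mainTheorem9 {R : Type u} [Ring R] [UniformSpace R] [IsUniformAddGroup R]
    [IsTopologicalRing R] [IsLinearTopology Rᵐᵒᵖ R] [T2Space R] [CompleteSpace R] :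
    (∀ (X : Type u) [PartialOrder X] [IsDirectedOrder X] (F : X ⥤ Contra.Contramodule R)
      (c : Cocone F), IsColimit c →
        (∀ x, Contra.IsStrictlyFlat 1 (F.obj x)) → Contra.IsStrictlyFlat 1 c.pt) ∧
    (∀ (X : Type u) [PartialOrder X] [IsDirectedOrder X] (F : X ⥤ Contra.Contramodule R)
      (c : Cocone F), IsColimit c →
        (∀ x, Projective (F.obj x)) → Contra.IsStrictlyFlat 1 c.pt) :=
  ⟨fun _ _ _ _ _ hc h => Contra.isStrictlyFlat_one_of_isColimit hc h,
    fun _ _ _ F _ hc h => Contra.isStrictlyFlat_one_of_isColimit hc fun x =>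
      haveI := h x
      Contra.isStrictlyFlat_one_of_projective (F.obj x)⟩
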